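/- Let $d, r$ be integers with $r \ge d \ge 1$, and let $G \in \mathbb{R}^{d\times r}$ be a Gaussian random matrix whose entries are i.i.d. real random variables with law $\mathcal{N}\left(0,\frac1r\right)$. Define $$\alpha_{\mathbb{R}}(d,r) := \mathbb{E}\left[\frac1d\sum_{j=1}^d \sigma_j(G)\right],$$ where $\sigma_1(G)\ge\dots\ge\sigma_d(G)\ge 0$ are the singular values of $G$, counted with multiplicity. Then this expectation is finite, and $$\alpha_{\mathbb{R}}(d,r) \ge 1 - \sqrt{\frac{d}{r}}.$$ -/

import Mathlib

open MeasureTheory ProbabilityTheory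
open scoped NNReal

noncomputable section

/-- The law of a `d × r` real Gaussian random matrix whose entries are independent and identically
distributed with law `𝒩(0, 1/r)` (mean `0`, variance `1/r`), as a measure on arrays of entries. -/
def gaussianMatrixLaw (d r : ℕ) : Measure (Fin d → Fin r → ℝ) :=
  Measure.pi fun _ : Fin d => Measure.pi fun _ : Fin r => gaussianReal 0 ((r : ℝ≥0)⁻¹)

/-- The `j`-th singular value (zero-indexed, in decreasing order, with multiplicity) of a real
`d × r` matrix `G`, viewed as a linear map between the Euclidean spaces `ℝ^r → ℝ^d`. -/
def matrixSingularValue {d r : ℕ} (G : Matrix (Fin d) (Fin r) ℝ) (j : ℕ) : ℝ :=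
  (Matrix.toEuclideanLin G).singularValues j

/-- The average `(1/d) ∑_{j=1}^d σ_j(G)` of the `d` largest singular values of a `d × r` matrix
(for `d ≤ r` these are all of its `min d r` singular values). -/
def avgSingularValue {d r : ℕ} (G : Matrix (Fin d) (Fin r) ℝ) : ℝ :=
  (1 / (d : ℝ)) * ∑ j : Fin d, matrixSingularValue G j

/-- `α_ℝ(d, r)`: the expected average singular value of a `d × r` Gaussian random matrix with
i.i.d. `𝒩(0, 1/r)` entries. -/
def alphaR (d r : ℕ) : ℝ :=
  ∫ g, avgSingularValue (Matrix.of g) ∂(gaussianMatrixLaw d r)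

end

/-! For `s ≥ 0` one has `s ≥ (3 s² - s⁴) / 2`. Summed over the singular values, this bounds `∑ σ_j`
below by traces of `GᵀG` and `(GᵀG)²`, polynomials in the entries. Their Gaussian expectations are
`d` and `d (1 + (d + 1) / r)`, so `α ≥ 1 - (d + 1) / (2r) ≥ 1 - d / r ≥ 1 - √(d / r)`, using `1 ≤ d
≤ r`. Finiteness follows from `s ≤ s² + 1`, once `∑ σ_j` is known to be measurable. -/

lemma LinearMap.IsSymmetric.pow_apply_eigenvectorBasis {E : Type*} [NormedAddCommGroup E]
    [InnerProductSpace ℝ E] [FiniteDimensional ℝ E] {n : ℕ} {T : E →ₗ[ℝ] E} (hT : T.IsSymmetric)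
    (hn : Module.finrank ℝ E = n) (k : ℕ) (i : Fin n) :
    (T ^ k) (hT.eigenvectorBasis hn i) = hT.eigenvalues hn i ^ k • hT.eigenvectorBasis hn i := by
  induction k with
  | zero => simp
  | succ k ih =>
    rw [pow_succ', Module.End.mul_apply, ih, map_smul, hT.apply_eigenvectorBasis, smul_smul,
      pow_succ]
    rfl

lemma LinearMap.IsSymmetric.trace_pow_eq_sum_eigenvalues_pow {E : Type*} [NormedAddCommGroup E]
    [InnerProductSpace ℝ E] [FiniteDimensional ℝ E] {n : ℕ} {T : E →ₗ[ℝ] E} (hT : T.IsSymmetric)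
    (hn : Module.finrank ℝ E = n) (k : ℕ) :
    LinearMap.trace ℝ E (T ^ k) = ∑ i, hT.eigenvalues hn i ^ k := by
  rw [LinearMap.trace_eq_sum_inner _ (hT.eigenvectorBasis hn)]
  refine Finset.sum_congr rfl fun i _ => ?_
  rw [hT.pow_apply_eigenvectorBasis hn, inner_smul_right]
  simp

lemma Matrix.trace_toEuclideanLin {n : ℕ} (A : Matrix (Fin n) (Fin n) ℝ) :
    LinearMap.trace ℝ _ (Matrix.toEuclideanLin A) = A.trace := by
  rw [Matrix.toEuclideanLin_eq_toLin_orthonormal, Matrix.trace_toLin_eq]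

/-- The `σ_j²` are the eigenvalues of `GᵀG`. This matrix is `r × r`, so the sum has `r` terms; those
with index at least `d` have `σ_j = 0`. -/
lemma sum_sq_matrixSingularValue_pow {d r : ℕ} (G : Matrix (Fin d) (Fin r) ℝ) (k : ℕ) :
    ∑ j : Fin r, (matrixSingularValue G j ^ 2) ^ k = ((G.transpose * G) ^ k).trace := by
  set T := Matrix.toEuclideanLin G
  have hS : LinearMap.adjoint T ∘ₗ T = Matrix.toEuclideanLin (G.transpose * G) := by
    rw [← Matrix.toEuclideanLin_conjTranspose_eq_adjoint, Matrix.conjTranspose_eq_transpose_of_trivial]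
    exact (Matrix.toLpLin_mul_same 2 _ _).symm
  have hn : Module.finrank ℝ (EuclideanSpace ℝ (Fin r)) = r := by simp
  have h := T.isSymmetric_adjoint_comp_self.trace_pow_eq_sum_eigenvalues_pow hn k
  simp only [matrixSingularValue, LinearMap.sq_singularValues_fin _ hn]
  rw [← h, hS, ← Matrix.trace_toEuclideanLin]
  congr 1
  exact (Matrix.toLpLin_pow 2 _ _).symm

lemma matrixSingularValue_nonneg {d r : ℕ} (G : Matrix (Fin d) (Fin r) ℝ) (j : ℕ) :
    0 ≤ matrixSingularValue G j :=
  LinearMap.singularValues_nonneg _ _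

lemma matrixSingularValue_eq_zero {d r : ℕ} (G : Matrix (Fin d) (Fin r) ℝ) {j : ℕ} (hj : d ≤ j) :
    matrixSingularValue G j = 0 := by
  refine (LinearMap.singularValues_eq_zero_iff_le_finrank_range _).2 (le_trans ?_ hj)
  simpa using Submodule.finrank_le (Matrix.toEuclideanLin G).range

lemma sum_matrixSingularValue_eq {d r : ℕ} (hdr : d ≤ r) (G : Matrix (Fin d) (Fin r) ℝ) :
    ∑ j : Fin d, matrixSingularValue G j = ∑ j : Fin r, matrixSingularValue G j := by
  rw [Fin.sum_univ_eq_sum_range (matrixSingularValue G),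
    Fin.sum_univ_eq_sum_range (matrixSingularValue G)]
  refine Finset.sum_subset (Finset.range_mono hdr) fun j _ hj => ?_
  exact matrixSingularValue_eq_zero G (by simpa using hj)

lemma sum_matrixSingularValue_sq {d r : ℕ} (G : Matrix (Fin d) (Fin r) ℝ) :
    ∑ j : Fin r, matrixSingularValue G j ^ 2 = ∑ a, ∑ i, G a i ^ 2 := by
  have h := sum_sq_matrixSingularValue_pow G 1
  simp only [pow_one] at h
  rw [h, Finset.sum_comm]
  simp [Matrix.trace, Matrix.mul_apply, sq]

lemma sum_matrixSingularValue_pow_four {d r : ℕ} (G : Matrix (Fin d) (Fin r) ℝ) :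
    ∑ j : Fin r, matrixSingularValue G j ^ 4
      = ∑ i, ∑ j, ∑ a, ∑ b, (G a i * G a j) * (G b i * G b j) := by
  have h := sum_sq_matrixSingularValue_pow G 2
  simp only [← pow_mul] at h
  rw [h, sq]
  simp only [Matrix.trace, Matrix.diag, Matrix.mul_apply (M := G.transpose * G),
    Matrix.mul_apply (M := G.transpose), Matrix.transpose_apply, Finset.sum_mul_sum]
  simp only [mul_comm]

/-- The difference of the two sides is `s (s - 1)² (s + 2) / 2`; they touch at `s = 1`. -/
lemma mul_sq_sub_pow_four_le {s : ℝ} (hs : 0 ≤ s) : (3 * s ^ 2 - s ^ 4) / 2 ≤ s := by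
  nlinarith [mul_nonneg (mul_nonneg hs (sq_nonneg (s - 1))) (by linarith : 0 ≤ s + 2)]

/-- Power sums of the `σ_j²` are traces, hence continuous in the entries. By Weierstrass, `√` is a
pointwise limit on `[0, ∞)` of polynomials `q n`, so `∑ σ_j` is a limit of measurable functions. -/
lemma measurable_sum_matrixSingularValue (d r : ℕ) :
    Measurable fun g : Fin d → Fin r → ℝ => ∑ j : Fin r, matrixSingularValue (Matrix.of g) j := by
  have hpow : ∀ k : ℕ, Measurable fun g : Fin d → Fin r → ℝ =>
      ∑ j : Fin r, (matrixSingularValue (Matrix.of g) j ^ 2) ^ k := fun k => by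
    simp only [sum_sq_matrixSingularValue_pow]
    refine Continuous.measurable ?_
    have : Continuous fun g : Fin d → Fin r → ℝ => Matrix.of g := continuous_id
    exact ((this.matrix_transpose.matrix_mul this).pow k).matrix_trace
  have hpoly : ∀ p : Polynomial ℝ, Measurable fun g : Fin d → Fin r → ℝ =>
      ∑ j : Fin r, p.eval (matrixSingularValue (Matrix.of g) j ^ 2) := fun p => by
    simp only [Polynomial.eval_eq_sum_range]
    simp_rw [Finset.sum_comm (s := (Finset.univ : Finset (Fin r))), ← Finset.mul_sum]
    exact Finset.measurable_sum _ fun k _ => (hpow k).const_mul _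
  have hq : ∀ n : ℕ, ∃ q : Polynomial ℝ, ∀ x ∈ Set.Icc (0 : ℝ) n,
      |q.eval x - √x| < 1 / ((n : ℝ) + 1) := fun n =>
    exists_polynomial_near_of_continuousOn 0 n _ Real.continuous_sqrt.continuousOn _ (by positivity)
  choose q hq using hq
  refine measurable_of_tendsto_metrizable (fun n => hpoly (q n)) ?_
  rw [tendsto_pi_nhds]
  refine fun g => tendsto_finsetSum _ fun j _ => ?_
  rw [tendsto_iff_dist_tendsto_zero]
  refine squeeze_zero' (.of_forall fun _ => dist_nonneg) ?_ tendsto_one_div_add_atTop_nhds_zero_nat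
  -- From this `n` on, `σ_j²` lies in `[0, n]`, where `q n` approximates `√`.
  filter_upwards [Filter.eventually_ge_atTop ⌈matrixSingularValue (Matrix.of g) j ^ 2⌉₊] with n hn
  have := (hq n _ ⟨sq_nonneg _, Nat.ceil_le.1 hn⟩).le
  rwa [Real.sqrt_sq (matrixSingularValue_nonneg _ _)] at this

/-! ### Gaussian moments and independence of entries -/

lemma hasDerivAt_mul_exp_mul_sq (v : ℝ) {p : ℝ → ℝ} {p' t : ℝ} (hp : HasDerivAt p p' t) :
    HasDerivAt (fun t => p t * Real.exp (v * t ^ 2 / 2))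
      ((p' + v * t * p t) * Real.exp (v * t ^ 2 / 2)) t := by
  have h : HasDerivAt (fun t : ℝ => v * t ^ 2 / 2) (v * t) t := by
    refine (((hasDerivAt_pow 2 t).const_mul v).div_const 2).congr_deriv ?_
    norm_num
    ring
  refine (hp.mul h.exp).congr_deriv ?_
  ring

lemma integral_pow_four_gaussianReal (v : ℝ≥0) :
    ∫ x, x ^ 4 ∂gaussianReal 0 v = 3 * (v : ℝ) ^ 2 := by
  have h := iteratedDeriv_mgf_zero (X := fun x : ℝ => x) (μ := gaussianReal 0 v)
    (by simp) 4
  simp only [Pi.pow_apply] at h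
  rw [← h, mgf_fun_id_gaussianReal]
  generalize (v : ℝ) = w
  have e0 : (fun t => Real.exp (0 * t + w * t ^ 2 / 2))
      = fun t => (1 : ℝ) * Real.exp (w * t ^ 2 / 2) := by
    ext t; simp
  have e1 : deriv (fun t => (1 : ℝ) * Real.exp (w * t ^ 2 / 2))
      = fun t => (w * t) * Real.exp (w * t ^ 2 / 2) := by
    ext t
    rw [(hasDerivAt_mul_exp_mul_sq w (hasDerivAt_const t (1 : ℝ))).deriv]; ring
  have e2 : deriv (fun t => (w * t) * Real.exp (w * t ^ 2 / 2))
      = fun t => (w + w ^ 2 * t ^ 2) * Real.exp (w * t ^ 2 / 2) := by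
    ext t
    rw [(hasDerivAt_mul_exp_mul_sq w ((hasDerivAt_id' t).const_mul w)).deriv]; ring
  have e3 : deriv (fun t => (w + w ^ 2 * t ^ 2) * Real.exp (w * t ^ 2 / 2))
      = fun t => (3 * w ^ 2 * t + w ^ 3 * t ^ 3) * Real.exp (w * t ^ 2 / 2) := by
    ext t
    rw [(hasDerivAt_mul_exp_mul_sq w
      (((hasDerivAt_pow 2 t).const_mul (w ^ 2)).const_add w)).deriv]; norm_num; ring
  have e4 : deriv (fun t => (3 * w ^ 2 * t + w ^ 3 * t ^ 3) * Real.exp (w * t ^ 2 / 2)) 0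
      = 3 * w ^ 2 := by
    rw [(hasDerivAt_mul_exp_mul_sq w (((hasDerivAt_id' (0 : ℝ)).const_mul (3 * w ^ 2)).fun_add
      ((hasDerivAt_pow 3 (0 : ℝ)).const_mul (w ^ 3)))).deriv]; norm_num
  rw [e0, iteratedDeriv_succ, iteratedDeriv_succ, iteratedDeriv_succ, iteratedDeriv_one,
    e1, e2, e3, e4]

lemma integral_sq_gaussianReal (v : ℝ≥0) : ∫ x, x ^ 2 ∂gaussianReal 0 v = (v : ℝ) := by
  rw [← variance_fun_id_gaussianReal (μ := 0) (v := v),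
    variance_eq_integral measurable_id'.aemeasurable]
  simp

lemma integrable_pow_gaussianReal (v : ℝ≥0) (n : ℕ) :
    Integrable (fun x : ℝ => x ^ n) (gaussianReal 0 v) := by
  have := (memLp_id_gaussianReal (μ := 0) (v := v) n).integrable_norm_pow'
  refine (integrable_norm_iff (by fun_prop)).1 ?_
  simpa using this

instance instIsProbabilityMeasureGaussianMatrixLaw (d r : ℕ) :
    IsProbabilityMeasure (gaussianMatrixLaw d r) := by
  unfold gaussianMatrixLaw; infer_instance

lemma measurable_entry {d r : ℕ} (a : Fin d) (i : Fin r) :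
    Measurable fun g : Fin d → Fin r → ℝ => g a i := by
  fun_prop

lemma measurePreserving_entry_gaussianMatrixLaw {d r : ℕ} (a : Fin d) (i : Fin r) :
    MeasurePreserving (fun g : Fin d → Fin r → ℝ => g a i) (gaussianMatrixLaw d r)
      (gaussianReal 0 (r : ℝ≥0)⁻¹) :=
  (measurePreserving_eval (fun _ : Fin r => gaussianReal 0 (r : ℝ≥0)⁻¹) i).comp
    (measurePreserving_eval
      (fun _ : Fin d => Measure.pi fun _ : Fin r => gaussianReal 0 (r : ℝ≥0)⁻¹) a)

lemma integrable_entry_pow {d r : ℕ} (a : Fin d) (i : Fin r) (n : ℕ) :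
    Integrable (fun g : Fin d → Fin r → ℝ => g a i ^ n) (gaussianMatrixLaw d r) :=
  (measurePreserving_entry_gaussianMatrixLaw a i).integrable_comp_of_integrable
    (integrable_pow_gaussianReal _ n)

lemma integral_entry_comp {d r : ℕ} (a : Fin d) (i : Fin r) {f : ℝ → ℝ} (hf : Measurable f) :
    ∫ g, f (g a i) ∂gaussianMatrixLaw d r = ∫ x, f x ∂gaussianReal 0 (r : ℝ≥0)⁻¹ := by
  rw [← (measurePreserving_entry_gaussianMatrixLaw a i).map_eq,
    integral_map (measurable_entry a i).aemeasurable hf.aestronglyMeasurable]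

lemma integral_entry_sq {d r : ℕ} (a : Fin d) (i : Fin r) :
    ∫ g, g a i ^ 2 ∂gaussianMatrixLaw d r = (r : ℝ)⁻¹ := by
  rw [integral_entry_comp a i (f := fun x => x ^ 2) (by fun_prop), integral_sq_gaussianReal]
  simp

lemma indepFun_rows {d r : ℕ} {a b : Fin d} (hab : a ≠ b) :
    IndepFun (fun g : Fin d → Fin r → ℝ => g a) (fun g => g b) (gaussianMatrixLaw d r) :=
  (iIndepFun_pi (X := fun _ x => x)
    (μ := fun _ : Fin d => Measure.pi fun _ : Fin r => gaussianReal 0 (r : ℝ≥0)⁻¹)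
    fun _ => aemeasurable_id).indepFun hab

/-- Independence under the law of one row is pulled back along the measure-preserving projection to
row `a`. -/
lemma indepFun_entries {d r : ℕ} (a : Fin d) {i j : Fin r} (hij : i ≠ j) :
    IndepFun (fun g : Fin d → Fin r → ℝ => g a i) (fun g => g a j) (gaussianMatrixLaw d r) := by
  have h := (iIndepFun_pi (X := fun _ x => x) (μ := fun _ : Fin r => gaussianReal 0 (r : ℝ≥0)⁻¹)
    fun _ => aemeasurable_id).indepFun hij
  have hp := measurePreserving_eval
    (fun _ : Fin d => Measure.pi fun _ : Fin r => gaussianReal 0 (r : ℝ≥0)⁻¹) a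
  rw [← hp.map_eq] at h
  rw [indepFun_iff_measure_inter_preimage_eq_mul] at h ⊢
  intro s t hs ht
  have := h s t hs ht
  rw [hp.map_eq, ← hp.measure_preimage, ← hp.measure_preimage, ← hp.measure_preimage] at this
  · exact this
  all_goals
    refine MeasurableSet.nullMeasurableSet ?_
    measurability

lemma integral_entry_mul_entry {d r : ℕ} (a : Fin d) (i j : Fin r) :
    ∫ g, g a i * g a j ∂gaussianMatrixLaw d r = if i = j then (r : ℝ)⁻¹ else 0 := by
  split_ifs with hij
  · subst hij
    simp only [← sq, integral_entry_sq]
  · rw [(indepFun_entries a hij).integral_fun_mul_eq_mul_integral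
      (measurable_entry a i).aestronglyMeasurable (measurable_entry a j).aestronglyMeasurable,
      integral_entry_comp a i (f := fun x => x) measurable_id]
    simp

/-- Wick's formula: the three terms are the three pairings of the four entries. -/
lemma integral_four_entries {d r : ℕ} (a b : Fin d) (i j : Fin r) :
    ∫ g, (g a i * g a j) * (g b i * g b j) ∂gaussianMatrixLaw d r
      = ((if a = b then 1 else 0) + (if i = j then 1 else 0)
        + (if a = b then 1 else 0) * (if i = j then 1 else 0)) * (r : ℝ)⁻¹ ^ 2 := by
  by_cases hab : a = b
  · subst hab
    by_cases hij : i = j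
    · subst hij
      have := integral_entry_comp a i (f := fun x => x ^ 4) (by fun_prop)
      rw [integral_pow_four_gaussianReal] at this
      simp only [if_true]
      convert this using 1
      · congr 1 with g
        ring
      · push_cast
        ring
    · have := ((indepFun_entries a hij).comp (φ := fun x => x ^ 2) (ψ := fun x => x ^ 2)
        (by fun_prop) (by fun_prop)).integral_fun_mul_eq_mul_integral
        ((measurable_entry a i).pow_const 2).aestronglyMeasurable
        ((measurable_entry a j).pow_const 2).aestronglyMeasurable
      simp only [Function.comp, integral_entry_sq] at this
      simp only [if_true, if_neg hij]
      convert this using 1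
      · congr 1 with g
        ring
      · ring
  · have := ((indepFun_rows (r := r) hab).comp (φ := fun x => x i * x j)
      (ψ := fun x => x i * x j) (by fun_prop) (by fun_prop)).integral_fun_mul_eq_mul_integral
      (by fun_prop) (by fun_prop)
    simp only [Function.comp, integral_entry_mul_entry] at this
    rw [this, if_neg hab]
    split_ifs <;> ring

lemma integrable_four_entries {d r : ℕ} (a b : Fin d) (i j : Fin r) :
    Integrable (fun g : Fin d → Fin r → ℝ => (g a i * g a j) * (g b i * g b j))
      (gaussianMatrixLaw d r) := by
  refine ((((integrable_entry_pow a i 4).add (integrable_entry_pow a j 4)).add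
    (integrable_entry_pow b i 4)).add (integrable_entry_pow b j 4)).mono' (by fun_prop)
    (.of_forall fun g => ?_)
  simp only [Pi.add_apply, Real.norm_eq_abs]
  generalize g a i = x, g a j = y, g b i = z, g b j = w
  rw [abs_le]
  constructor <;>
    nlinarith [sq_nonneg (x ^ 2 - y ^ 2), sq_nonneg (z ^ 2 - w ^ 2), sq_nonneg (x * y - z * w),
      sq_nonneg (x * y + z * w), sq_nonneg (x ^ 2 + y ^ 2), sq_nonneg (z ^ 2 + w ^ 2),
      sq_nonneg (x ^ 2), sq_nonneg (y ^ 2), sq_nonneg (z ^ 2), sq_nonneg (w ^ 2)]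

/-! ### Expected second and fourth power sums -/

lemma integrable_sum_matrixSingularValue_sq (d r : ℕ) :
    Integrable (fun g : Fin d → Fin r → ℝ =>
      ∑ j : Fin r, matrixSingularValue (Matrix.of g) j ^ 2) (gaussianMatrixLaw d r) := by
  simp only [sum_matrixSingularValue_sq, Matrix.of_apply]
  exact integrable_finsetSum _ fun a _ => integrable_finsetSum _ fun i _ =>
    integrable_entry_pow a i 2

lemma integrable_sum_matrixSingularValue_pow_four (d r : ℕ) :
    Integrable (fun g : Fin d → Fin r → ℝ =>
      ∑ j : Fin r, matrixSingularValue (Matrix.of g) j ^ 4) (gaussianMatrixLaw d r) := by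
  simp only [sum_matrixSingularValue_pow_four, Matrix.of_apply]
  exact integrable_finsetSum _ fun i _ => integrable_finsetSum _ fun j _ =>
    integrable_finsetSum _ fun a _ => integrable_finsetSum _ fun b _ =>
    integrable_four_entries a b i j

lemma integral_sum_matrixSingularValue_sq (d : ℕ) {r : ℕ} (hr : r ≠ 0) :
    ∫ g, ∑ j : Fin r, matrixSingularValue (Matrix.of g) j ^ 2 ∂gaussianMatrixLaw d r = d := by
  simp only [sum_matrixSingularValue_sq, Matrix.of_apply]
  rw [integral_finsetSum _ fun a _ => integrable_finsetSum _ fun i _ =>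
    integrable_entry_pow a i 2]
  simp_rw [integral_finsetSum _ fun i _ => integrable_entry_pow _ i 2, integral_entry_sq]
  simp [hr]

lemma integral_sum_matrixSingularValue_pow_four (d : ℕ) {r : ℕ} (hr : r ≠ 0) :
    ∫ g, ∑ j : Fin r, matrixSingularValue (Matrix.of g) j ^ 4 ∂gaussianMatrixLaw d r
      = d * (1 + (d + 1) / r) := by
  have h4 := fun (i j : Fin r) (a b : Fin d) => integrable_four_entries a b i j
  have h3 := fun i j a => integrable_finsetSum Finset.univ fun b _ => h4 i j a b
  have h2 := fun i j => integrable_finsetSum Finset.univ fun a _ => h3 i j a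
  have h1 := fun i => integrable_finsetSum Finset.univ fun j _ => h2 i j
  simp only [sum_matrixSingularValue_pow_four, Matrix.of_apply]
  have key : ∀ i j : Fin r, ∫ g, ∑ a, ∑ b, (g a i * g a j) * (g b i * g b j) ∂gaussianMatrixLaw d r
      = (d + d ^ 2 * (if i = j then 1 else 0) + d * (if i = j then 1 else 0)) * (r : ℝ)⁻¹ ^ 2 := by
    intro i j
    rw [integral_finsetSum _ fun a _ => h3 i j a]
    rw [Finset.sum_congr rfl fun a _ => integral_finsetSum _ fun b _ => h4 i j a b]
    simp_rw [integral_four_entries, ← Finset.sum_mul, Finset.sum_add_distrib, ← Finset.sum_mul]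
    congr 1
    split_ifs <;> simp <;> ring
  rw [integral_finsetSum _ fun i _ => h1 i,
    Finset.sum_congr rfl fun i _ => integral_finsetSum _ fun j _ => h2 i j]
  simp_rw [key, ← Finset.sum_mul, Finset.sum_add_distrib, ← Finset.mul_sum]
  simp
  field_simp
  ring

theorem mainTheorem6 (d r : ℕ) (hd : 1 ≤ d) (hdr : d ≤ r) :
    Integrable (fun g : Fin d → Fin r → ℝ => avgSingularValue (Matrix.of g)) (gaussianMatrixLaw d r) ∧
      1 - Real.sqrt ((d : ℝ) / (r : ℝ)) ≤ alphaR d r := by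
  have hr : r ≠ 0 := by omega
  have hd' : (1 : ℝ) ≤ d := by exact_mod_cast hd
  have hdr' : (d : ℝ) ≤ r := by exact_mod_cast hdr
  have i2 := integrable_sum_matrixSingularValue_sq d r
  have i4 := integrable_sum_matrixSingularValue_pow_four d r
  have hi : Integrable (fun g : Fin d → Fin r → ℝ =>
      ∑ j : Fin r, matrixSingularValue (Matrix.of g) j) (gaussianMatrixLaw d r) := by
    refine (i2.add (integrable_const (r : ℝ))).mono'
      (measurable_sum_matrixSingularValue d r).aestronglyMeasurable (.of_forall fun g => ?_)
    rw [Real.norm_of_nonneg (Finset.sum_nonneg fun j _ => matrixSingularValue_nonneg _ _)]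
    have hc : (r : ℝ) = ∑ _j : Fin r, (1 : ℝ) := by simp
    rw [Pi.add_apply, hc, ← Finset.sum_add_distrib]
    refine Finset.sum_le_sum fun j _ => ?_
    nlinarith [sq_nonneg (matrixSingularValue (Matrix.of g) j - 1),
      sq_nonneg (matrixSingularValue (Matrix.of g) j)]
  simp only [alphaR, avgSingularValue, sum_matrixSingularValue_eq hdr]
  refine ⟨hi.const_mul _, ?_⟩
  rw [integral_const_mul]
  have hle : (3 * (d : ℝ) - d * (1 + (d + 1) / r)) / 2 ≤
      ∫ g, ∑ j : Fin r, matrixSingularValue (Matrix.of g) j ∂gaussianMatrixLaw d r := by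
    rw [← integral_sum_matrixSingularValue_pow_four d hr]
    conv_lhs => enter [1, 1]; rw [← integral_sum_matrixSingularValue_sq d hr]
    rw [← integral_const_mul, ← integral_sub (i2.const_mul 3) i4, ← integral_div]
    refine integral_mono (((i2.const_mul 3).sub i4).div_const 2) hi fun g => ?_
    simp only [Finset.mul_sum]
    rw [← Finset.sum_sub_distrib, Finset.sum_div]
    exact Finset.sum_le_sum fun j _ => mul_sq_sub_pow_four_le (matrixSingularValue_nonneg _ _)
  have hr0 : (0 : ℝ) < r := by linarith
  have hx : (d : ℝ) / r ≤ √((d : ℝ) / r) := by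
    refine Real.le_sqrt_of_sq_le ?_
    have h1 : (d : ℝ) / r ≤ 1 := (div_le_one hr0).2 hdr'
    have h0 : 0 ≤ (d : ℝ) / r := by positivity
    nlinarith
  -- Here `d ≥ 1` is what absorbs the extra `1`.
  have hy : ((d : ℝ) + 1) / r ≤ 2 * (d / r) := by
    rw [← mul_div_assoc]
    gcongr
    linarith
  calc 1 - √((d : ℝ) / r) ≤ 1 / (d : ℝ) * ((3 * (d : ℝ) - d * (1 + (d + 1) / r)) / 2) := by
        have : 1 / (d : ℝ) * ((3 * (d : ℝ) - d * (1 + (d + 1) / r)) / 2)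
            = 1 - ((d : ℝ) + 1) / r / 2 := by
          field_simp
          ring
        linarith
    _ ≤ _ := by gcongr
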